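/- Let $E$ be a finite-dimensional real Banach space and let $C\subseteq E$ be an open convex cone (i.e. $C$ is open and closed under addition and under multiplication by positive scalars) whose closure $\overline C$ is proper, $\overline C\cap(-\overline C)=\{0\}$. For $x,y\in E$ write $x\le y$ if $y-x\in\overline C$. Equip $C$ with the topology inherited from $E$ and with the Thompson metric $$d_T(x,y)=\max\{\log M(x/y),\ \log M(y/x)\},\qquad M(x/y)=\inf\{\lambda>0:\ x\le\lambda y\},$$ which induces this topology (with the convention $\log 0=0$, relevant only if $E=\{0\}$). Let $\mathcal P(C)$ be the set of Borel probability measures on $C$, with the stochastic order: $\mu\le\nu$ if $\mu(U)\le\nu(U)$ for every open upper set $U\subseteq C$, where $U\subseteq C$ is an upper set if $x\in U$, $y\in C$ and $x\le y$ imply $y\in U$. For $1\le p<\infty$ let $\mathcal P^p(C)$ be the set of those $\mu\in\mathcal P(C)$ with $\int_C d_T(x,y)^p\,d\mu(y)<\infty$ for some (equivalently, every) $x\in C$, equipped with the $p$-Wasserstein metric $$d_p^W(\mu,\nu)=\Bigl[\inf_{\pi\in\Pi(\mu,\nu)}\int_{C\times C}d_T(x,y)^p\,d\pi(x,y)\Bigr]^{1/p},$$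 where $\Pi(\mu,\nu)$ is the set of Borel probability measures on $C\times C$ with marginals $\mu$ and $\nu$. Let $\nu_1,\nu_2\in\mathcal P(C)$ with $\nu_1\le\nu_2$, and let $[\nu_1,\nu_2]=\{\mu\in\mathcal P(C):\nu_1\le\mu\le\nu_2\}$. (1) The order interval $[\nu_1,\nu_2]$ is compact in the weak topology of $\mathcal P(C)$, i.e. the topology of convergence of integrals of bounded continuous functions. (2) Let $1\le p<\infty$. If $\nu_1,\nu_2\in\mathcal P^p(C)$, then $[\nu_1,\nu_2]\subseteq\mathcal P^p(C)$ and $[\nu_1,\nu_2]$ is compact in the topology of the metric $d_p^W$. -/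

import Mathlib

open Set MeasureTheory
open scoped Pointwise ENNReal

namespace OpenCone

section Order

variable {E : Type*} [NormedAddCommGroup E] [NormedSpace ℝ E]

/-- The order on `E` defined by the cone `closure C`: `x ≤ y` iff `y - x ∈ closure C`. -/
def ConeLE (C : ConvexCone ℝ E) (x y : E) : Prop :=
  y - x ∈ closure (C : Set E)

/-- The points of `C`, with the topology and the measurable structure inherited from `E`. -/
abbrev Points (C : ConvexCone ℝ E) : Type _ :=
  ↥(C : Set E)

/-- A subset `U` of `C` is an upper set if `x ∈ U`, `y ∈ C` and `x ≤ y` imply `y ∈ U`. -/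
def IsUpper (C : ConvexCone ℝ E) (U : Set (Points C)) : Prop :=
  ∀ x ∈ U, ∀ y : Points C, ConeLE C x y → y ∈ U

/-- `M(x/y) = inf {t > 0 : x ≤ t y}`. -/
noncomputable def ratio (C : ConvexCone ℝ E) (x y : E) : ℝ :=
  sInf {t : ℝ | 0 < t ∧ ConeLE C x (t • y)}

/-- The Thompson metric `d_T(x, y) = max {log M(x/y), log M(y/x)}` on `C`. -/
noncomputable def thompsonDist (C : ConvexCone ℝ E) (x y : Points C) : ℝ :=
  max (Real.log (ratio C x y)) (Real.log (ratio C y x))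

end Order

section Measures

variable {E : Type*} [NormedAddCommGroup E] [NormedSpace ℝ E] [MeasurableSpace E]

/-- The stochastic order on Borel probability measures on `C`:
`μ ≤ ν` iff `μ U ≤ ν U` for every open upper set `U` of `C`. -/
def StochLE (C : ConvexCone ℝ E) (μ ν : ProbabilityMeasure (Points C)) : Prop :=
  ∀ U : Set (Points C), IsOpen U → IsUpper C U →
    (μ : Measure (Points C)) U ≤ (ν : Measure (Points C)) U

/-- The order interval `[ν₁, ν₂]` of the stochastic order. -/
def stochInterval (C : ConvexCone ℝ E) (ν₁ ν₂ : ProbabilityMeasure (Points C)) :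
    Set (ProbabilityMeasure (Points C)) :=
  {μ | StochLE C ν₁ μ ∧ StochLE C μ ν₂}

/-- `μ` has finite `p`-th moment for the Thompson metric, that is `∫ d_T(x, y)^p dμ(y) < ∞` for
some (equivalently, every) `x ∈ C`. -/
def HasFiniteMoment (C : ConvexCone ℝ E) (p : ℝ) (μ : ProbabilityMeasure (Points C)) : Prop :=
  ∃ x : Points C,
    ∫⁻ y, ENNReal.ofReal (thompsonDist C x y ^ p) ∂(μ : Measure (Points C)) < ∞

/-- The couplings of `μ` and `ν`: probability measures on `C × C` with marginals `μ` and `ν`. -/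
def couplings (C : ConvexCone ℝ E) (μ ν : ProbabilityMeasure (Points C)) :
    Set (ProbabilityMeasure (Points C × Points C)) :=
  {π | (π : Measure (Points C × Points C)).map Prod.fst = μ ∧
    (π : Measure (Points C × Points C)).map Prod.snd = ν}

/-- The `p`-Wasserstein distance for the Thompson metric,
`(inf over couplings π of ∫ d_T(x, y)^p dπ(x, y))^(1/p)`. The integrals are taken in `[0, ∞]`;
the infimum is finite when `μ` and `ν` have finite `p`-th moment. -/
noncomputable def wassersteinDist (C : ConvexCone ℝ E) (p : ℝ)
    (μ ν : ProbabilityMeasure (Points C)) : ℝ :=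
  (⨅ π ∈ couplings C μ ν,
    ∫⁻ z, ENNReal.ofReal (thompsonDist C z.1 z.2 ^ p)
      ∂(π : Measure (Points C × Points C))).toReal ^ (1 / p)

/-- The space of Borel probability measures on `C` with finite `p`-th moment. It carries the
Wasserstein topology defined below, and not the subspace topology of the weak topology. -/
def WassersteinSpace (C : ConvexCone ℝ E) (p : ℝ) : Type _ :=
  {μ : ProbabilityMeasure (Points C) // HasFiniteMoment C p μ}

/-- The underlying probability measure. -/
def WassersteinSpace.toProb {C : ConvexCone ℝ E} {p : ℝ} (μ : WassersteinSpace C p) :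
    ProbabilityMeasure (Points C) :=
  μ.1

/-- The topology of the metric `wassersteinDist C p`: a set is open if it contains a ball of
positive radius around each of its points. -/
instance WassersteinSpace.instTopologicalSpace (C : ConvexCone ℝ E) (p : ℝ) :
    TopologicalSpace (WassersteinSpace C p) where
  IsOpen U := ∀ μ ∈ U, ∃ ε > 0, ∀ ν : WassersteinSpace C p,
    wassersteinDist C p μ.toProb ν.toProb < ε → ν ∈ U
  isOpen_univ := fun _ _ => ⟨1, one_pos, fun _ _ => mem_univ _⟩
  isOpen_inter := by
    rintro U V hU hV μ ⟨h1, h2⟩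
    obtain ⟨a, ha, hUa⟩ := hU μ h1
    obtain ⟨b, hb, hVb⟩ := hV μ h2
    exact ⟨min a b, lt_min ha hb, fun ν hν =>
      ⟨hUa ν (hν.trans_le (min_le_left _ _)), hVb ν (hν.trans_le (min_le_right _ _))⟩⟩
  isOpen_sUnion := by
    rintro S hS μ ⟨U, hU, hμ⟩
    obtain ⟨a, ha, hUa⟩ := hS U hU μ hμ
    exact ⟨a, ha, fun ν hν => ⟨U, hU, hUa ν hν⟩⟩

end Measures

end OpenCone

/-!
The order interval is compact because it is closed and tight for the weak topology, and the
Wasserstein topology adds nothing on it, because the `p`-th powers of the Thompson distance are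
uniformly integrable there.

*Closedness.* For `μ ≤ ν₂` this is the portmanteau inequality for open sets. For `ν₁ ≤ μ` that
inequality points the wrong way; instead an open upper set `U` is exhausted by the dilates
`{x | s • x ∈ U}`, `s < 1`, which are open upper sets whose closures lie in `U`
(`closure_smul_mem_subset`), and the portmanteau inequality for closed sets applies to these
closures.

*Tightness.* The order intervals `{x | e / n ≤ x ≤ n e}` are compact, a proper cone in finite
dimension being normal (`exists_norm_le_of_coneLE`), and they exhaust `C`. The mass missing above
is that of an upper set, hence at most its `ν₂`-mass; the mass missing below is that of a lower
set, hence at most its `ν₁`-mass. Prokhorov's theorem gives the weak compactness.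

*Uniform integrability.* The distance `d_T(e, x)` is the maximum of `log M(x/e)`, monotone in `x`,
and `log M(e/x)`, antitone in `x`. By the layer cake formula the tail integrals of the first are
largest at `ν₂`, those of the second at `ν₁` (`lintegral_excess_thompsonDist_le`).

*From weak to Wasserstein neighbourhoods.* A measure `ν` weakly close to `μ` shares with it, up to
moves of small cost, almost all of its mass: a finite continuous partition of unity `φ i` on a
compact set, subordinate to sets of small diameter, gives the partial coupling
`∑ i, (φ i • μ) × (φ i • ν) / max (∫ φ i dμ) (∫ φ i dν)`, whose mass depends continuously on `ν`
(`eventually_exists_partial_coupling`). The remainders have small mass, so by uniform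
integrability small moments, and are coupled by their product. Thus the inclusion of the interval
with its weak topology into the Wasserstein space is continuous
(`eventually_wassersteinDist_lt`), and its image is compact. The triangle inequality for the
Wasserstein distance is not needed.
-/

namespace OpenCone

/-! ### The order of an open cone -/

section Cone

open Filter Topology

variable {E : Type*} [NormedAddCommGroup E] [NormedSpace ℝ E] {C : ConvexCone ℝ E}

theorem zero_mem_closure (hP : closure (C : Set E) ∩ -closure (C : Set E) = {0}) :
    (0 : E) ∈ closure (C : Set E) :=
  (hP.symm ▸ mem_singleton (0 : E) : (0 : E) ∈ closure (C : Set E) ∩ -closure (C : Set E)).1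

theorem ConeLE.trans {x y z : E} (hxy : ConeLE C x y) (hyz : ConeLE C y z) : ConeLE C x z := by
  have h : (z - y) + (y - x) ∈ C.closure := C.closure.add_mem hyz hxy
  simpa [ConeLE] using h

theorem ConeLE.smul {x y : E} (h : ConeLE C x y) {t : ℝ} (ht : 0 < t) :
    ConeLE C (t • x) (t • y) := by
  have : t • (y - x) ∈ C.closure := C.closure.smul_mem ht h
  rwa [smul_sub] at this

theorem ConeLE.of_sub_mem {x y : E} (h : y - x ∈ C) : ConeLE C x y :=
  subset_closure h

/-- An open convex cone absorbs its closure: `C + closure C ⊆ C`. -/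
theorem add_mem_of_mem_closure (hO : IsOpen (C : Set E)) {x k : E} (hx : x ∈ C)
    (hk : k ∈ closure (C : Set E)) : x + k ∈ C := by
  have h : x + k ∈ (C : Set E) + closure (C : Set E) := add_mem_add hx hk
  rw [hO.add_closure] at h
  obtain ⟨a, ha, b, hb, hab⟩ := h
  exact hab ▸ C.add_mem ha hb

theorem mem_of_coneLE (hO : IsOpen (C : Set E)) {x y : E} (hx : x ∈ C) (h : ConeLE C x y) :
    y ∈ C := by
  simpa using add_mem_of_mem_closure hO hx h

/-- Unless `E` is trivial, a proper open cone does not contain the origin. -/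
theorem subsingleton_of_zero_mem (hO : IsOpen (C : Set E))
    (hP : closure (C : Set E) ∩ -closure (C : Set E) = {0}) (h0 : (0 : E) ∈ C) :
    Subsingleton E := by
  refine subsingleton_of_forall_eq 0 fun v => ?_
  have key : ∀ w : E, ∀ᶠ t : ℝ in 𝓝[>] 0, t • w ∈ (C : Set E) := fun w => by
    have : Tendsto (fun t : ℝ => t • w) (𝓝 0) (𝓝 0) := by
      simpa using (by fun_prop : Continuous fun t : ℝ => t • w).tendsto (0 : ℝ)
    exact (this.eventually (hO.mem_nhds h0)).filter_mono nhdsWithin_le_nhds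
  obtain ⟨t, ⟨h1, h2⟩, ht⟩ :=
    (((key v).and (key (-v))).and (self_mem_nhdsWithin (a := (0 : ℝ)) (s := Ioi 0))).exists
  have : t • v ∈ closure (C : Set E) ∩ -closure (C : Set E) :=
    ⟨subset_closure h1, by
      rw [Set.mem_neg, ← smul_neg]
      exact subset_closure h2⟩
  rw [hP] at this
  exact (smul_eq_zero.1 this).resolve_left (ne_of_gt ht)

theorem ne_zero_of_mem [Nontrivial E] (hO : IsOpen (C : Set E))
    (hP : closure (C : Set E) ∩ -closure (C : Set E) = {0}) {x : E} (hx : x ∈ C) : x ≠ 0 := by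
  rintro rfl
  exact not_subsingleton E (subsingleton_of_zero_mem hO hP hx)

/-- Every point of an open cone is an order unit. -/
theorem eventually_coneLE_smul (hO : IsOpen (C : Set E)) (x : E) {y : E} (hy : y ∈ C) :
    ∀ᶠ t : ℝ in atTop, ConeLE C x (t • y) := by
  have h : Tendsto (fun t : ℝ => y - t⁻¹ • x) atTop (𝓝 y) := by
    simpa using tendsto_const_nhds.sub
      ((tendsto_inv_atTop_zero (𝕜 := ℝ)).smul (tendsto_const_nhds (x := x)))
  filter_upwards [h.eventually (hO.mem_nhds hy), eventually_gt_atTop 0] with t ht h0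
  refine ConeLE.of_sub_mem ?_
  have := C.smul_mem h0 ht
  rwa [smul_sub, smul_inv_smul₀ h0.ne'] at this

theorem ratio_nonneg (x y : E) : 0 ≤ ratio C x y :=
  Real.sInf_nonneg fun _ ht => ht.1.le

theorem ratio_le {x y : E} {t : ℝ} (ht : 0 < t) (h : ConeLE C x (t • y)) : ratio C x y ≤ t :=
  csInf_le ⟨0, fun _ hs => hs.1.le⟩ ⟨ht, h⟩

/-- The infimum defining `ratio C x y` is attained, up to the positivity constraint. -/
theorem coneLE_ratio_smul (hO : IsOpen (C : Set E)) (x : E) {y : E} (hy : y ∈ C) :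
    ConeLE C x (ratio C x y • y) := by
  have hne : {t : ℝ | 0 < t ∧ ConeLE C x (t • y)}.Nonempty := by
    obtain ⟨t, h1, h2⟩ := ((eventually_coneLE_smul hO x hy).and (eventually_gt_atTop 0)).exists
    exact ⟨t, h2, h1⟩
  have hcl : IsClosed {t : ℝ | ConeLE C x (t • y)} :=
    isClosed_closure.preimage (by fun_prop : Continuous fun t : ℝ => t • y - x)
  exact closure_minimal (fun t ht => ht.2) hcl
    (csInf_mem_closure hne ⟨0, fun _ hs => hs.1.le⟩)

theorem ratio_pos [Nontrivial E] (hO : IsOpen (C : Set E))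
    (hP : closure (C : Set E) ∩ -closure (C : Set E) = {0}) {x y : E} (hx : x ∈ C) (hy : y ∈ C) :
    0 < ratio C x y := by
  refine (ratio_nonneg x y).lt_of_ne fun h => ne_zero_of_mem hO hP hx ?_
  have h1 := coneLE_ratio_smul hO x hy
  rw [← h, ConeLE, zero_smul, zero_sub] at h1
  have : x ∈ closure (C : Set E) ∩ -closure (C : Set E) := ⟨subset_closure hx, h1⟩
  rwa [hP] at this

/-- The logarithm of `M(x/y)`. For `E = {0}` it vanishes, as `log 0 = 0`. -/
noncomputable def logRatio (C : ConvexCone ℝ E) (x y : E) : ℝ :=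
  Real.log (ratio C x y)

theorem thompsonDist_eq (x y : Points C) :
    thompsonDist C x y = max (logRatio C x y) (logRatio C y x) :=
  rfl

theorem logRatio_eq_zero_of_subsingleton [Subsingleton E]
    (hP : closure (C : Set E) ∩ -closure (C : Set E) = {0}) (x y : E) : logRatio C x y = 0 := by
  have : {t : ℝ | 0 < t ∧ ConeLE C x (t • y)} = Ioi 0 := by
    ext t
    have h : ConeLE C x (t • y) := by
      rw [ConeLE, Subsingleton.elim (t • y - x) 0]
      exact zero_mem_closure hP
    simp only [h, and_true, mem_ofPred_eq, mem_Ioi]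
  simp [logRatio, ratio, this]

theorem logRatio_le {x y : E} {s : ℝ} (hs : 0 ≤ s) (h : ConeLE C x (Real.exp s • y)) :
    logRatio C x y ≤ s := by
  rcases (ratio_nonneg (C := C) x y).eq_or_lt with h0 | h0
  · simpa [logRatio, ← h0] using hs
  · exact (Real.log_le_iff_le_exp h0).2 (ratio_le (Real.exp_pos s) h)

theorem logRatio_triangle (hO : IsOpen (C : Set E))
    (hP : closure (C : Set E) ∩ -closure (C : Set E) = {0}) {x y z : E}
    (hx : x ∈ C) (hy : y ∈ C) (hz : z ∈ C) :
    logRatio C x z ≤ logRatio C x y + logRatio C y z := by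
  rcases subsingleton_or_nontrivial E with _ | _
  · simp [logRatio_eq_zero_of_subsingleton hP]
  · have h1 := ratio_pos hO hP hx hy
    have h2 := ratio_pos hO hP hy hz
    rw [logRatio, logRatio, logRatio, ← Real.log_mul h1.ne' h2.ne']
    refine Real.log_le_log (ratio_pos hO hP hx hz) (ratio_le (mul_pos h1 h2) ?_)
    rw [mul_smul]
    exact (coneLE_ratio_smul hO x hy).trans ((coneLE_ratio_smul hO y hz).smul h1)

theorem logRatio_nonpos_of_coneLE {x y : E} (h : ConeLE C x y) : logRatio C x y ≤ 0 :=
  logRatio_le le_rfl (by simpa using h)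

theorem logRatio_mono_left (hO : IsOpen (C : Set E))
    (hP : closure (C : Set E) ∩ -closure (C : Set E) = {0}) {x y z : E}
    (hx : x ∈ C) (hy : y ∈ C) (hz : z ∈ C) (h : ConeLE C x y) :
    logRatio C x z ≤ logRatio C y z := by
  linarith [logRatio_triangle hO hP hx hy hz, logRatio_nonpos_of_coneLE h]

theorem logRatio_anti_right (hO : IsOpen (C : Set E))
    (hP : closure (C : Set E) ∩ -closure (C : Set E) = {0}) {x y z : E}
    (hx : x ∈ C) (hy : y ∈ C) (hz : z ∈ C) (h : ConeLE C x y) :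
    logRatio C z y ≤ logRatio C z x := by
  linarith [logRatio_triangle hO hP hz hx hy, logRatio_nonpos_of_coneLE h]

theorem eventually_logRatio_le (hO : IsOpen (C : Set E)) {x : E} (hx : x ∈ C) {s : ℝ}
    (hs : 0 < s) : ∀ᶠ y in 𝓝 x, logRatio C y x ≤ s ∧ logRatio C x y ≤ s := by
  have hmem : Real.exp s • x - x ∈ C := by
    have : Real.exp s • x - x = (Real.exp s - 1) • x := by rw [sub_smul, one_smul]
    rw [this]
    exact C.smul_mem (by linarith [Real.add_one_lt_exp hs.ne']) hx
  have c1 : Continuous fun y : E => Real.exp s • x - y := by fun_prop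
  have c2 : Continuous fun y : E => Real.exp s • y - x := by fun_prop
  filter_upwards [c1.continuousAt.eventually (hO.mem_nhds hmem),
    c2.continuousAt.eventually (hO.mem_nhds hmem)] with y h1 h2
  exact ⟨logRatio_le hs.le (ConeLE.of_sub_mem h1), logRatio_le hs.le (ConeLE.of_sub_mem h2)⟩

theorem continuous_logRatio (hO : IsOpen (C : Set E))
    (hP : closure (C : Set E) ∩ -closure (C : Set E) = {0}) :
    Continuous fun q : Points C × Points C => logRatio C q.1 q.2 := by
  rw [continuous_iff_continuousAt]
  rintro ⟨⟨x, hx⟩, ⟨y, hy⟩⟩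
  rw [ContinuousAt, Metric.tendsto_nhds]
  intro ε hε
  have h1 : ∀ᶠ q : Points C × Points C in 𝓝 (⟨x, hx⟩, ⟨y, hy⟩),
      logRatio C q.1 x ≤ ε / 3 ∧ logRatio C x q.1 ≤ ε / 3 :=
    ((continuous_subtype_val.comp continuous_fst).tendsto
      ((⟨x, hx⟩, ⟨y, hy⟩) : Points C × Points C)).eventually
      (eventually_logRatio_le hO hx (by positivity : 0 < ε / 3))
  have h2 : ∀ᶠ q : Points C × Points C in 𝓝 (⟨x, hx⟩, ⟨y, hy⟩),
      logRatio C q.2 y ≤ ε / 3 ∧ logRatio C y q.2 ≤ ε / 3 :=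
    ((continuous_subtype_val.comp continuous_snd).tendsto
      ((⟨x, hx⟩, ⟨y, hy⟩) : Points C × Points C)).eventually
      (eventually_logRatio_le hO hy (by positivity : 0 < ε / 3))
  filter_upwards [h1, h2]
  rintro ⟨⟨x', hx'⟩, ⟨y', hy'⟩⟩ ⟨a1, a2⟩ ⟨b1, b2⟩
  dsimp only at a1 a2 b1 b2
  rw [Real.dist_eq, abs_lt]
  have t1 := logRatio_triangle hO hP hx' hx hy'
  have t2 := logRatio_triangle hO hP hx hy hy'
  have t3 := logRatio_triangle hO hP hx hx' hy
  have t4 := logRatio_triangle hO hP hx' hy' hy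
  constructor <;> dsimp only <;> linarith

theorem continuous_logRatio_right (hO : IsOpen (C : Set E))
    (hP : closure (C : Set E) ∩ -closure (C : Set E) = {0}) (e : Points C) :
    Continuous fun x : Points C => logRatio C e x :=
  Continuous.comp (g := fun q : Points C × Points C => logRatio C q.1 q.2)
    (f := fun x => (e, x)) (continuous_logRatio hO hP) (Continuous.prodMk_right e)

theorem continuous_logRatio_left (hO : IsOpen (C : Set E))
    (hP : closure (C : Set E) ∩ -closure (C : Set E) = {0}) (e : Points C) :
    Continuous fun x : Points C => logRatio C x e :=
  Continuous.comp (g := fun q : Points C × Points C => logRatio C q.1 q.2)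
    (f := fun x => (x, e)) (continuous_logRatio hO hP) (Continuous.prodMk_left e)

theorem logRatio_self (hP : closure (C : Set E) ∩ -closure (C : Set E) = {0})
    (hO : IsOpen (C : Set E)) {x : E} (hx : x ∈ C) : logRatio C x x = 0 := by
  refine le_antisymm (logRatio_nonpos_of_coneLE ?_) ?_
  · simpa [ConeLE] using zero_mem_closure hP
  · linarith [logRatio_triangle hO hP hx hx hx]

/-! ### The Thompson metric -/

theorem continuous_thompsonDist (hO : IsOpen (C : Set E))
    (hP : closure (C : Set E) ∩ -closure (C : Set E) = {0}) :
    Continuous fun q : Points C × Points C => thompsonDist C q.1 q.2 :=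
  (continuous_logRatio hO hP).max ((continuous_logRatio hO hP).comp continuous_swap)

theorem thompsonDist_self (hO : IsOpen (C : Set E))
    (hP : closure (C : Set E) ∩ -closure (C : Set E) = {0}) (x : Points C) :
    thompsonDist C x x = 0 := by
  simp [thompsonDist_eq, logRatio_self hP hO x.2]

theorem thompsonDist_comm (x y : Points C) : thompsonDist C x y = thompsonDist C y x :=
  max_comm _ _

theorem thompsonDist_triangle (hO : IsOpen (C : Set E))
    (hP : closure (C : Set E) ∩ -closure (C : Set E) = {0}) (x y z : Points C) :
    thompsonDist C x z ≤ thompsonDist C x y + thompsonDist C y z :=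
  max_le
    ((logRatio_triangle hO hP x.2 y.2 z.2).trans
      (add_le_add (le_max_left _ _) (le_max_left _ _)))
    ((logRatio_triangle hO hP z.2 y.2 x.2).trans
      ((add_le_add (le_max_right _ _) (le_max_right _ _)).trans_eq (add_comm _ _)))

theorem thompsonDist_nonneg (hO : IsOpen (C : Set E))
    (hP : closure (C : Set E) ∩ -closure (C : Set E) = {0}) (x y : Points C) :
    0 ≤ thompsonDist C x y := by
  have := thompsonDist_triangle hO hP x y x
  rw [thompsonDist_self hO hP, thompsonDist_comm y x] at this
  linarith

theorem continuous_thompsonDist_right (hO : IsOpen (C : Set E))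
    (hP : closure (C : Set E) ∩ -closure (C : Set E) = {0}) (e : Points C) :
    Continuous fun x : Points C => thompsonDist C e x :=
  Continuous.comp (g := fun q : Points C × Points C => thompsonDist C q.1 q.2)
    (f := fun x => (e, x)) (continuous_thompsonDist hO hP) (Continuous.prodMk_right e)

theorem continuous_cost (hO : IsOpen (C : Set E))
    (hP : closure (C : Set E) ∩ -closure (C : Set E) = {0}) {p : ℝ} (hp : 0 ≤ p) :
    Continuous fun z : Points C × Points C => thompsonDist C z.1 z.2 ^ p :=
  (continuous_thompsonDist hO hP).rpow_const fun _ => Or.inr hp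

theorem exists_mem_nhds_cost_le (hO : IsOpen (C : Set E))
    (hP : closure (C : Set E) ∩ -closure (C : Set E) = {0}) {p : ℝ} (hp : 0 < p) (x : Points C)
    {δ : ℝ} (hδ : 0 < δ) :
    ∃ U ∈ 𝓝 x, ∀ y ∈ U, ∀ z ∈ U,
      ENNReal.ofReal (thompsonDist C y z ^ p) ≤ ENNReal.ofReal δ := by
  have hcont := (continuous_cost hO hP hp.le).continuousAt (x := (x, x))
  have h0 : thompsonDist C x x ^ p < δ := by
    rwa [thompsonDist_self hO hP, Real.zero_rpow hp.ne']
  have hx : ∀ᶠ z : Points C × Points C in 𝓝 x ×ˢ 𝓝 x, thompsonDist C z.1 z.2 ^ p < δ := by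
    rw [← nhds_prod_eq]
    exact hcont.eventually_lt_const h0
  obtain ⟨U, hU, hUx⟩ := eventually_prod_self_iff'.1 hx
  exact ⟨U, hU, fun y hy z hz => ENNReal.ofReal_le_ofReal (hUx y hy z hz).le⟩

/-! ### Compactness of order intervals of points -/

/-- Normality of a proper cone in finite dimension: on the unit sphere `-u` keeps a positive
distance from `closure C` for `u ∈ closure C`, which bounds the norm of any `x` between `0`
and `a`. -/
theorem exists_norm_le_of_coneLE [FiniteDimensional ℝ E]
    (hP : closure (C : Set E) ∩ -closure (C : Set E) = {0}) (a : E) :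
    ∃ R : ℝ, ∀ x ∈ closure (C : Set E), ConeLE C x a → ‖x‖ ≤ R := by
  have : ProperSpace E := FiniteDimensional.proper ℝ E
  set K : Set E := closure (C : Set E) with hK
  have h0 : (0 : E) ∈ K := zero_mem_closure hP
  rcases (Metric.sphere (0 : E) 1 ∩ K).eq_empty_or_nonempty with hS | hS
  · refine ⟨0, fun x hx _ => ?_⟩
    by_contra hn
    have hn' : 0 < ‖x‖ := not_le.1 hn
    have : ‖x‖⁻¹ • x ∈ Metric.sphere (0 : E) 1 ∩ K :=
      ⟨by simp [norm_smul, hn'.ne'], C.closure.smul_mem (inv_pos.2 hn') hx⟩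
    simp [hS] at this
  · have hcomp : IsCompact (Metric.sphere (0 : E) 1 ∩ K) :=
      (isCompact_sphere 0 1).inter_right isClosed_closure
    obtain ⟨u, ⟨hu1, huK⟩, hmin⟩ := hcomp.exists_isMinOn hS
      (f := fun u : E => Metric.infDist (-u) K)
      ((Metric.continuous_infDist_pt K).comp continuous_neg).continuousOn
    have hc : 0 < Metric.infDist (-u) K := by
      refine (isClosed_closure.notMem_iff_infDist_pos ⟨0, h0⟩).1 fun h => ?_
      have : u ∈ K ∩ -K := ⟨huK, h⟩
      rw [hP] at this
      rw [mem_singleton_iff.1 this] at hu1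
      simp at hu1
    refine ⟨‖a‖ / Metric.infDist (-u) K, fun x hx hxa => ?_⟩
    rcases eq_or_ne x 0 with rfl | hx0
    · simpa using div_nonneg (norm_nonneg a) hc.le
    have hn : 0 < ‖x‖ := norm_pos_iff.2 hx0
    have h1 : ‖x‖⁻¹ • x ∈ Metric.sphere (0 : E) 1 ∩ K :=
      ⟨by simp [norm_smul, hn.ne'], C.closure.smul_mem (inv_pos.2 hn) hx⟩
    have h2 : ‖x‖⁻¹ • (a - x) ∈ K := C.closure.smul_mem (inv_pos.2 hn) hxa
    have h3 := (hmin h1).trans (Metric.infDist_le_dist_of_mem h2)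
    have h4 : dist (-(‖x‖⁻¹ • x)) (‖x‖⁻¹ • (a - x)) = ‖a‖ / ‖x‖ := by
      rw [dist_eq_norm, smul_sub]
      have : -(‖x‖⁻¹ • x) - (‖x‖⁻¹ • a - ‖x‖⁻¹ • x) = -(‖x‖⁻¹ • a) := by abel
      rw [this, norm_neg, norm_smul, norm_inv, norm_norm, div_eq_inv_mul]
    rw [h4, le_div_iff₀ hn] at h3
    rw [le_div_iff₀ hc]
    linarith

theorem isCompact_setOf_coneLE [FiniteDimensional ℝ E] (hO : IsOpen (C : Set E))
    (hP : closure (C : Set E) ∩ -closure (C : Set E) = {0}) {a : E} (ha : a ∈ C) (b : E) :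
    IsCompact {x : Points C | ConeLE C a x ∧ ConeLE C x b} := by
  have : ProperSpace E := FiniteDimensional.proper ℝ E
  rw [Topology.IsEmbedding.subtypeVal.isCompact_iff]
  have himg : Subtype.val '' {x : Points C | ConeLE C a x ∧ ConeLE C x b} =
      {x : E | ConeLE C a x ∧ ConeLE C x b} := by
    ext x
    constructor
    · rintro ⟨y, hy, rfl⟩
      exact hy
    · exact fun hx => ⟨⟨x, mem_of_coneLE hO ha hx.1⟩, hx, rfl⟩
  rw [himg]
  obtain ⟨R, hR⟩ := exists_norm_le_of_coneLE hP b
  refine Metric.isCompact_of_isClosed_isBounded ?_ ?_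
  · exact (isClosed_closure.preimage (by fun_prop : Continuous fun x : E => x - a)).inter
      (isClosed_closure.preimage (by fun_prop : Continuous fun x : E => b - x))
  · refine (Metric.isBounded_closedBall (x := (0 : E)) (r := R)).subset fun x hx => ?_
    exact mem_closedBall_zero_iff.2 (hR x (subset_closure (mem_of_coneLE hO ha hx.1)) hx.2)

/-! ### Dilates of open upper sets -/

/-- An open upper set `U` is the increasing union of the dilates `{x | s • x ∈ U}` with `s < 1`,
and since `s • x` lies strictly below `x`, the closures of these dilates stay in `U`. -/
theorem closure_smul_mem_subset (hO : IsOpen (C : Set E)) {U : Set (Points C)}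
    (hU' : IsUpper C U) {s : ℝ} (hs : 0 < s) (hs1 : s < 1) :
    closure {x : Points C | (⟨s • (x : E), C.smul_mem hs x.2⟩ : Points C) ∈ U} ⊆ U := by
  intro x hx
  have hmem : (x : E) - s • (x : E) ∈ C := by
    have : (x : E) - s • (x : E) = (1 - s) • (x : E) := by rw [sub_smul, one_smul]
    rw [this]
    exact C.smul_mem (by linarith) x.2
  have hc : Continuous fun y : Points C => (x : E) - s • (y : E) := by fun_prop
  obtain ⟨y, hy1, hy2⟩ := mem_closure_iff_nhds.1 hx _
    (hc.continuousAt.preimage_mem_nhds (hO.mem_nhds hmem))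
  exact hU' _ hy2 x (ConeLE.of_sub_mem hy1)

end Cone

/-! ### Weak compactness of order intervals of measures -/

section Weak

open Filter Topology

variable {E : Type*} [NormedAddCommGroup E] [NormedSpace ℝ E]
  [MeasurableSpace E] [BorelSpace E] {C : ConvexCone ℝ E}
  {μ ν ν₁ ν₂ : ProbabilityMeasure (Points C)}

theorem StochLE.measure_compl_le (h : StochLE C μ ν) {U : Set (Points C)} (hU : IsOpen U)
    (hU' : IsUpper C U) : (ν : Measure (Points C)) Uᶜ ≤ (μ : Measure (Points C)) Uᶜ := by
  rw [prob_compl_eq_one_sub hU.measurableSet, prob_compl_eq_one_sub hU.measurableSet]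
  exact tsub_le_tsub_left (h U hU hU') 1

theorem isClosed_setOf_stochLE_left (ν : ProbabilityMeasure (Points C)) :
    IsClosed {μ : ProbabilityMeasure (Points C) | StochLE C μ ν} := by
  rw [isClosed_iff_forall_filter]
  intro μ F hF hFS hFμ U hU hU'
  refine (ProbabilityMeasure.le_liminf_measure_open_of_tendsto (μs := id) hFμ hU).trans ?_
  refine liminf_le_of_frequently_le' (Eventually.frequently ?_)
  filter_upwards [le_principal_iff.1 hFS] with μ' hμ'
  exact hμ' U hU hU'

theorem isClosed_setOf_stochLE_right (hO : IsOpen (C : Set E))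
    (ν : ProbabilityMeasure (Points C)) :
    IsClosed {μ : ProbabilityMeasure (Points C) | StochLE C ν μ} := by
  rw [isClosed_iff_forall_filter]
  intro μ F hF hFS hFμ U hU hU'
  -- `s n` lies in `(0, 1)` and increases to `1`, also for `n = 0`
  let s : ℕ → ℝ := fun n => 1 - 1 / ((n : ℝ) + 2)
  have hs : ∀ n, 0 < s n := fun n => by
    have : 1 / ((n : ℝ) + 2) < 1 := by
      rw [div_lt_one (by positivity)]
      linarith [n.cast_nonneg (α := ℝ)]
    simpa [s] using this
  have hs1 : ∀ n, s n < 1 := fun n => by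
    have : 0 < 1 / ((n : ℝ) + 2) := by positivity
    simpa [s] using this
  have hsm : Monotone s := fun m n hmn => by
    have : (m : ℝ) ≤ n := by exact_mod_cast hmn
    simp only [s]
    gcongr
  have hlim : Tendsto s atTop (𝓝 1) := by
    have h := (tendsto_one_div_add_atTop_nhds_zero_nat (𝕜 := ℝ)).comp (tendsto_add_atTop_nat 1)
    have h' := h.const_sub 1
    simp only [sub_zero] at h'
    refine h'.congr fun n => ?_
    simp only [s, Function.comp_apply]
    push_cast
    ring
  let d : ℕ → Points C → Points C := fun n x => ⟨s n • (x : E), C.smul_mem (hs n) x.2⟩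
  have hd : ∀ n, Continuous (d n) := fun n => by fun_prop
  let V : ℕ → Set (Points C) := fun n => d n ⁻¹' U
  have hVo : ∀ n, IsOpen (V n) := fun n => hU.preimage (hd n)
  have hVup : ∀ n, IsUpper C (V n) := fun n x hx y hxy => hU' _ hx _ (hxy.smul (hs n))
  have hVm : Monotone V := fun m n hmn x hx => by
    refine hU' _ hx _ ?_
    rcases (hsm hmn).eq_or_lt with h | h
    · have : ConeLE C (s m • (x : E)) (s n • (x : E)) := by
        rw [ConeLE, h, sub_self, ← zero_smul ℝ (x : E)]
        exact map_mem_closure (f := fun t : ℝ => t • (x : E)) (by fun_prop)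
          (by rw [closure_Ioi]; exact self_mem_Ici : (0 : ℝ) ∈ closure (Ioi 0))
          fun t ht => C.smul_mem ht x.2
      exact this
    · refine ConeLE.of_sub_mem ?_
      have := C.smul_mem (sub_pos.2 h) x.2
      rwa [sub_smul] at this
  have hVU : U ⊆ ⋃ n, V n := fun x hx => by
    have : Tendsto (fun n => d n x) atTop (𝓝 x) := by
      rw [tendsto_subtype_rng]
      simpa [d] using hlim.smul_const (x : E)
    exact mem_iUnion.2 (this.eventually (hU.mem_nhds hx)).exists
  have key : ∀ n, (ν : Measure (Points C)) (V n) ≤ (μ : Measure (Points C)) U := fun n => by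
    refine le_trans ?_ (measure_mono (closure_smul_mem_subset hO hU' (hs n) (hs1 n)))
    refine le_trans ?_ (ProbabilityMeasure.limsup_measure_closed_le_of_tendsto (μs := id) hFμ
      isClosed_closure)
    refine le_limsup_of_frequently_le' (Eventually.frequently ?_)
    filter_upwards [le_principal_iff.1 hFS] with μ' hμ'
    exact (hμ' (V n) (hVo n) (hVup n)).trans (measure_mono subset_closure)
  calc (ν : Measure (Points C)) U ≤ (ν : Measure (Points C)) (⋃ n, V n) := measure_mono hVU
    _ = ⨆ n, (ν : Measure (Points C)) (V n) := hVm.measure_iUnion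
    _ ≤ _ := iSup_le key

theorem isClosed_stochInterval (hO : IsOpen (C : Set E)) (ν₁ ν₂ : ProbabilityMeasure (Points C)) :
    IsClosed (stochInterval C ν₁ ν₂) :=
  (isClosed_setOf_stochLE_right hO ν₁).inter (isClosed_setOf_stochLE_left ν₂)

/-- The compact sets `{x | e / (n + 1) ≤ x ≤ (n + 1) e}` exhaust `C`. The part of `C` not below
`(n + 1) e` is an upper set, so its mass is controlled by `ν₂`; the part not strictly above
`e / (n + 1)` is a lower set, so its mass is controlled by `ν₁`. -/
theorem isTightMeasureSet_stochInterval [FiniteDimensional ℝ E] (hO : IsOpen (C : Set E))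
    (hP : closure (C : Set E) ∩ -closure (C : Set E) = {0})
    (ν₁ ν₂ : ProbabilityMeasure (Points C)) :
    IsTightMeasureSet {((μ : ProbabilityMeasure (Points C)) : Measure (Points C)) |
      μ ∈ stochInterval C ν₁ ν₂} := by
  obtain ⟨e⟩ : Nonempty (Points C) := nonempty_of_isProbabilityMeasure (ν₁ : Measure (Points C))
  let r : ℕ → ℝ := fun n => n + 1
  have hr : ∀ n, 0 < r n := fun n => by positivity
  have hrm : Monotone r := fun m n hmn => by
    have : (m : ℝ) ≤ n := by exact_mod_cast hmn
    simp only [r]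
    linarith
  have hrt : Tendsto r atTop atTop :=
    tendsto_atTop_add_const_right _ _ tendsto_natCast_atTop_atTop
  have hsmul : ∀ {s t : ℝ}, s ≤ t → ConeLE C (s • (e : E)) (t • (e : E)) := fun {s t} hst => by
    have h0 : (0 : E) ∈ closure (C : Set E) := zero_mem_closure hP
    rcases hst.eq_or_lt with rfl | h
    · simpa only [ConeLE, sub_self] using h0
    · refine ConeLE.of_sub_mem ?_
      rw [← sub_smul]
      exact C.smul_mem (sub_pos.2 h) e.2
  let U : ℕ → Set (Points C) := fun n => {x | ConeLE C x (r n • (e : E))}ᶜ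
  let V : ℕ → Set (Points C) := fun n => {x | (x : E) - (r n)⁻¹ • (e : E) ∈ C}
  have hUo : ∀ n, IsOpen (U n) := fun n => by
    have hc : Continuous fun x : Points C => r n • (e : E) - (x : E) := by fun_prop
    exact (isClosed_closure.preimage hc).isOpen_compl
  have hVo : ∀ n, IsOpen (V n) := fun n => by
    have hc : Continuous fun x : Points C => (x : E) - (r n)⁻¹ • (e : E) := by fun_prop
    exact hO.preimage hc
  have hUup : ∀ n, IsUpper C (U n) := fun n x hx y hxy hy => hx (hxy.trans hy)
  have hVup : ∀ n, IsUpper C (V n) := fun n x hx y hxy => by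
    have := add_mem_of_mem_closure hO (show (x : E) - (r n)⁻¹ • (e : E) ∈ C from hx) hxy
    rwa [show (x : E) - (r n)⁻¹ • (e : E) + ((y : E) - x) = y - (r n)⁻¹ • (e : E) by abel] at this
  have hUlim : Tendsto (fun n => (ν₂ : Measure (Points C)) (U n)) atTop (𝓝 0) := by
    have hanti : Antitone U := fun m n hmn x hx hx' => hx (hx'.trans (hsmul (hrm hmn)))
    have hinter : ⋂ n, U n = ∅ := by
      refine eq_empty_of_forall_notMem fun x hx => ?_
      obtain ⟨n, hn⟩ := (hrt.eventually (eventually_coneLE_smul hO (x : E) e.2)).exists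
      exact mem_iInter.1 hx n hn
    have := tendsto_measure_iInter_atTop (μ := (ν₂ : Measure (Points C)))
      (fun n => (hUo n).measurableSet.nullMeasurableSet) hanti ⟨0, measure_ne_top _ _⟩
    rwa [hinter, measure_empty] at this
  have hVlim : Tendsto (fun n => (ν₁ : Measure (Points C)) (V n)ᶜ) atTop (𝓝 0) := by
    have hanti : Antitone fun n => (V n)ᶜ := fun m n hmn x hx hx' => hx <| by
      have h := add_mem_of_mem_closure hO (show (x : E) - (r m)⁻¹ • (e : E) ∈ C from hx')
        (hsmul (inv_anti₀ (hr m) (hrm hmn)))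
      rwa [sub_add_sub_cancel] at h
    have hinter : ⋂ n, (V n)ᶜ = ∅ := by
      refine eq_empty_of_forall_notMem fun x hx => ?_
      have hlim : Tendsto (fun n => (x : E) - (r n)⁻¹ • (e : E)) atTop (𝓝 x) := by
        simpa using tendsto_const_nhds.sub
          ((tendsto_inv_atTop_zero.comp hrt).smul (tendsto_const_nhds (x := (e : E))))
      obtain ⟨n, hn⟩ := (hlim.eventually (hO.mem_nhds x.2)).exists
      exact mem_iInter.1 hx n hn
    have := tendsto_measure_iInter_atTop (μ := (ν₁ : Measure (Points C)))
      (fun n => (hVo n).measurableSet.compl.nullMeasurableSet) hanti ⟨0, measure_ne_top _ _⟩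
    rwa [hinter, measure_empty] at this
  rw [isTightMeasureSet_iff_exists_isCompact_measure_compl_le]
  intro ε hε
  have hsum := hVlim.add hUlim
  rw [add_zero] at hsum
  obtain ⟨n, hn⟩ := (hsum.eventually (eventually_le_nhds hε)).exists
  refine ⟨_, isCompact_setOf_coneLE hO hP (C.smul_mem (inv_pos.2 (hr n)) e.2) (r n • (e : E)), ?_⟩
  rintro _ ⟨μ, hμ, rfl⟩
  refine le_trans ?_ hn
  calc (μ : Measure (Points C)) _ ≤ (μ : Measure (Points C)) ((V n)ᶜ ∪ U n) := by
        refine measure_mono fun x hx => ?_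
        by_contra hcon
        rw [mem_union, not_or, notMem_compl_iff, notMem_compl_iff] at hcon
        exact hx ⟨ConeLE.of_sub_mem hcon.1, hcon.2⟩
    _ ≤ (μ : Measure (Points C)) (V n)ᶜ + (μ : Measure (Points C)) (U n) := measure_union_le _ _
    _ ≤ _ := add_le_add (hμ.1.measure_compl_le (hVo n) (hVup n)) (hμ.2 _ (hUo n) (hUup n))

theorem isCompact_stochInterval [FiniteDimensional ℝ E] (hO : IsOpen (C : Set E))
    (hP : closure (C : Set E) ∩ -closure (C : Set E) = {0})
    (ν₁ ν₂ : ProbabilityMeasure (Points C)) : IsCompact (stochInterval C ν₁ ν₂) := by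
  have := isCompact_closure_of_isTightMeasureSet (isTightMeasureSet_stochInterval hO hP ν₁ ν₂)
  rwa [(isClosed_stochInterval hO ν₁ ν₂).closure_eq] at this

end Weak

/-! ### Excess functions -/

section Excess

open Filter Topology

/-- The amount by which the `p`-th power of the positive part of `t` exceeds `R`, a continuous
monotone substitute for the tail `t ^ p * 1_{t ^ p > R}`. -/
noncomputable def excess (p R t : ℝ) : ℝ :=
  max (max t 0 ^ p - R) 0

variable {p R : ℝ}

theorem excess_nonneg (t : ℝ) : 0 ≤ excess p R t :=
  le_max_right _ _

theorem monotone_excess (hp : 0 ≤ p) : Monotone (excess p R) := fun s t hst => by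
  unfold excess
  gcongr

theorem continuous_excess (hp : 0 ≤ p) : Continuous (excess p R) :=
  (((continuous_id.max continuous_const).rpow_const fun _ => Or.inr hp).sub
    continuous_const).max continuous_const

theorem excess_max_le (hp : 0 ≤ p) (s t : ℝ) :
    excess p R (max s t) ≤ excess p R s + excess p R t := by
  rw [(monotone_excess hp).map_max]
  exact max_le (le_add_of_nonneg_right (excess_nonneg _)) (le_add_of_nonneg_left (excess_nonneg _))

theorem rpow_le_add_excess {t : ℝ} (ht : 0 ≤ t) : t ^ p ≤ R + excess p R t := by
  have := le_max_left (max t 0 ^ p - R) 0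
  rw [max_eq_left ht] at this
  rw [excess, max_eq_left ht]
  linarith

theorem excess_le_rpow (hR : 0 ≤ R) {s t : ℝ} (hp : 0 ≤ p) (hst : s ≤ t) (ht : 0 ≤ t) :
    excess p R s ≤ t ^ p := by
  refine max_le ?_ (Real.rpow_nonneg ht p)
  have : max s 0 ^ p ≤ t ^ p := Real.rpow_le_rpow (le_max_right _ _) (max_le hst ht) hp
  linarith

theorem ofReal_add_rpow_le {a b : ℝ} (ha : 0 ≤ a) (hb : 0 ≤ b) (hp : 0 ≤ p) :
    ENNReal.ofReal ((a + b) ^ p) ≤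
      ENNReal.ofReal (2 ^ p) * (ENNReal.ofReal (a ^ p) + ENNReal.ofReal (b ^ p)) := by
  have hap := Real.rpow_nonneg ha p
  have hbp := Real.rpow_nonneg hb p
  rw [← ENNReal.ofReal_add hap hbp, ← ENNReal.ofReal_mul (by positivity)]
  refine ENNReal.ofReal_le_ofReal ?_
  calc (a + b) ^ p ≤ (2 * max a b) ^ p := by
        refine Real.rpow_le_rpow (by positivity) ?_ hp
        linarith [le_max_left a b, le_max_right a b]
    _ = 2 ^ p * max a b ^ p := Real.mul_rpow zero_le_two (le_max_of_le_left ha)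
    _ ≤ 2 ^ p * (a ^ p + b ^ p) := by
        gcongr
        rcases max_choice a b with h | h <;> rw [h] <;> linarith

/-- The excess over a growing threshold of a function with finite `p`-th moment integrates to
`0` in the limit. -/
theorem tendsto_lintegral_excess {X : Type*} [MeasurableSpace X] {ν : Measure X} {f g : X → ℝ}
    (hp : 0 ≤ p) (hf : Measurable f) (hfg : ∀ x, f x ≤ g x) (hg : ∀ x, 0 ≤ g x)
    (hfin : ∫⁻ x, ENNReal.ofReal (g x ^ p) ∂ν < ∞) :
    Tendsto (fun n : ℕ => ∫⁻ x, ENNReal.ofReal (excess p n (f x)) ∂ν) atTop (𝓝 0) := by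
  have h := tendsto_lintegral_of_dominated_convergence (μ := ν)
    (F := fun (n : ℕ) x => ENNReal.ofReal (excess p n (f x))) (f := fun _ => 0)
    (fun x => ENNReal.ofReal (g x ^ p))
    (fun n => ((continuous_excess hp).measurable.comp hf).ennreal_ofReal)
    (fun n => ae_of_all _ fun x =>
      ENNReal.ofReal_le_ofReal (excess_le_rpow n.cast_nonneg hp (hfg x) (hg x)))
    hfin.ne (ae_of_all _ fun x => ?_)
  · simpa using h
  · refine tendsto_const_nhds.congr' ?_
    filter_upwards [eventually_ge_atTop ⌈max (f x) 0 ^ p⌉₊] with n hn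
    have : excess p n (f x) = 0 := max_eq_right (sub_nonpos.2 (Nat.ceil_le.1 hn))
    simp [this]

end Excess

/-! ### Uniform integrability on order intervals of measures -/

section Integrals

open Filter Topology

variable {E : Type*} [NormedAddCommGroup E] [NormedSpace ℝ E]
  [MeasurableSpace E] {C : ConvexCone ℝ E}

/-- A measure `a ≤ m` of small mass has small `p`-th moment once the excess of `m` is small. -/
theorem lintegral_rpow_le_of_le (hO : IsOpen (C : Set E))
    (hP : closure (C : Set E) ∩ -closure (C : Set E) = {0}) {p R : ℝ} (hR : 0 ≤ R)
    (e : Points C) {a m : Measure (Points C)} (ha : a ≤ m) :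
    ∫⁻ x, ENNReal.ofReal (thompsonDist C e x ^ p) ∂a ≤ ENNReal.ofReal R * a univ +
      ∫⁻ x, ENNReal.ofReal (excess p R (thompsonDist C e x)) ∂m := by
  calc ∫⁻ x, ENNReal.ofReal (thompsonDist C e x ^ p) ∂a
      ≤ ∫⁻ x, (ENNReal.ofReal R + ENNReal.ofReal (excess p R (thompsonDist C e x))) ∂a := by
        refine lintegral_mono fun x => ?_
        rw [← ENNReal.ofReal_add hR (excess_nonneg _)]
        exact ENNReal.ofReal_le_ofReal (rpow_le_add_excess (thompsonDist_nonneg hO hP e x))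
    _ = ENNReal.ofReal R * a univ +
        ∫⁻ x, ENNReal.ofReal (excess p R (thompsonDist C e x)) ∂a := by
        rw [lintegral_add_left measurable_const, lintegral_const]
    _ ≤ _ := by
        gcongr

variable [BorelSpace E] {μ ν ν₁ ν₂ : ProbabilityMeasure (Points C)}

theorem StochLE.lintegral_le_of_monotone (h : StochLE C μ ν) {g : Points C → ℝ}
    (hg : Continuous g) (hg0 : ∀ x, 0 ≤ g x)
    (hmono : ∀ x y : Points C, ConeLE C x y → g x ≤ g y) :
    ∫⁻ x, ENNReal.ofReal (g x) ∂(μ : Measure (Points C)) ≤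
      ∫⁻ x, ENNReal.ofReal (g x) ∂(ν : Measure (Points C)) := by
  rw [lintegral_eq_lintegral_meas_lt _ (ae_of_all _ hg0) hg.measurable.aemeasurable,
    lintegral_eq_lintegral_meas_lt _ (ae_of_all _ hg0) hg.measurable.aemeasurable]
  exact lintegral_mono fun t => h _ (isOpen_lt continuous_const hg)
    fun x hx y hxy => lt_of_lt_of_le hx (hmono x y hxy)

theorem StochLE.lintegral_le_of_antitone (h : StochLE C μ ν) {g : Points C → ℝ}
    (hg : Continuous g) (hg0 : ∀ x, 0 ≤ g x)
    (hanti : ∀ x y : Points C, ConeLE C x y → g y ≤ g x) :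
    ∫⁻ x, ENNReal.ofReal (g x) ∂(ν : Measure (Points C)) ≤
      ∫⁻ x, ENNReal.ofReal (g x) ∂(μ : Measure (Points C)) := by
  rw [lintegral_eq_lintegral_meas_le _ (ae_of_all _ hg0) hg.measurable.aemeasurable,
    lintegral_eq_lintegral_meas_le _ (ae_of_all _ hg0) hg.measurable.aemeasurable]
  refine lintegral_mono fun t => ?_
  have := h.measure_compl_le (isOpen_lt hg (continuous_const (y := t)))
    fun x hx y hxy => lt_of_le_of_lt (hanti x y hxy) hx
  simpa only [compl_ofPred, not_lt] using this

/-- The Thompson distance to `e` is the maximum of a monotone and an antitone function, whose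
excesses are controlled by the upper and by the lower end of the interval. -/
theorem lintegral_excess_thompsonDist_le (hO : IsOpen (C : Set E))
    (hP : closure (C : Set E) ∩ -closure (C : Set E) = {0}) {p R : ℝ} (hp : 0 ≤ p)
    (hμ : μ ∈ stochInterval C ν₁ ν₂) (e : Points C) :
    ∫⁻ x, ENNReal.ofReal (excess p R (thompsonDist C e x)) ∂(μ : Measure (Points C)) ≤
      (∫⁻ x : Points C, ENNReal.ofReal (excess p R (logRatio C e x)) ∂(ν₁ : Measure (Points C))) +
      ∫⁻ x : Points C, ENNReal.ofReal (excess p R (logRatio C x e))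
        ∂(ν₂ : Measure (Points C)) := by
  have c1 : Continuous fun x : Points C => excess p R (logRatio C e x) :=
    (continuous_excess hp).comp (continuous_logRatio_right hO hP e)
  have c2 : Continuous fun x : Points C => excess p R (logRatio C x e) :=
    (continuous_excess hp).comp (continuous_logRatio_left hO hP e)
  refine le_trans (lintegral_mono fun x => ?_) ((lintegral_add_left
    c1.measurable.ennreal_ofReal
    fun x : Points C => ENNReal.ofReal (excess p R (logRatio C x e))).trans_le (add_le_add ?_ ?_))
  · rw [← ENNReal.ofReal_add (excess_nonneg _) (excess_nonneg _)]
    exact ENNReal.ofReal_le_ofReal (excess_max_le hp _ _)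
  · exact hμ.1.lintegral_le_of_antitone c1 (fun _ => excess_nonneg _)
      fun x y hxy => monotone_excess hp (logRatio_anti_right hO hP x.2 y.2 e.2 hxy)
  · exact hμ.2.lintegral_le_of_monotone c2 (fun _ => excess_nonneg _)
      fun x y hxy => monotone_excess hp (logRatio_mono_left hO hP x.2 y.2 e.2 hxy)

theorem HasFiniteMoment.lintegral_lt_top (hO : IsOpen (C : Set E))
    (hP : closure (C : Set E) ∩ -closure (C : Set E) = {0}) {p : ℝ} (hp : 0 ≤ p)
    (hν : HasFiniteMoment C p ν) (e : Points C) :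
    ∫⁻ y, ENNReal.ofReal (thompsonDist C e y ^ p) ∂(ν : Measure (Points C)) < ∞ := by
  obtain ⟨x, hx⟩ := hν
  have hm : Measurable fun y : Points C => ENNReal.ofReal (thompsonDist C x y ^ p) :=
    ((continuous_thompsonDist_right hO hP x).measurable.pow_const p).ennreal_ofReal
  refine lt_of_le_of_lt (lintegral_mono fun y => ?_)
    (b := ∫⁻ y, ENNReal.ofReal (2 ^ p) * (ENNReal.ofReal (thompsonDist C e x ^ p) +
      ENNReal.ofReal (thompsonDist C x y ^ p)) ∂(ν : Measure (Points C))) ?_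
  · refine le_trans (ENNReal.ofReal_le_ofReal ?_) (ofReal_add_rpow_le
      (thompsonDist_nonneg hO hP e x) (thompsonDist_nonneg hO hP x y) hp)
    exact Real.rpow_le_rpow (thompsonDist_nonneg hO hP e y) (thompsonDist_triangle hO hP e x y) hp
  · rw [lintegral_const_mul _ (hm.const_add _), lintegral_add_left measurable_const]
    refine ENNReal.mul_lt_top ENNReal.ofReal_lt_top (ENNReal.add_lt_top.2 ⟨?_, hx⟩)
    simp

theorem tendsto_lintegral_excess_logRatio (hO : IsOpen (C : Set E))
    (hP : closure (C : Set E) ∩ -closure (C : Set E) = {0}) {p : ℝ} (hp : 0 ≤ p)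
    (h₁ : HasFiniteMoment C p ν₁) (h₂ : HasFiniteMoment C p ν₂) (e : Points C) :
    Tendsto (fun n : ℕ =>
      (∫⁻ x : Points C, ENNReal.ofReal (excess p n (logRatio C e x)) ∂(ν₁ : Measure (Points C))) +
      ∫⁻ x : Points C, ENNReal.ofReal (excess p n (logRatio C x e)) ∂(ν₂ : Measure (Points C)))
      atTop (𝓝 0) := by
  have c1 : Continuous fun x : Points C => logRatio C e x :=
    continuous_logRatio_right hO hP e
  have c2 : Continuous fun x : Points C => logRatio C x e :=
    continuous_logRatio_left hO hP e
  simpa using (tendsto_lintegral_excess hp c1.measurable (fun x => le_max_left _ _)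
    (thompsonDist_nonneg hO hP e) (h₁.lintegral_lt_top hO hP hp e)).add
    (tendsto_lintegral_excess hp c2.measurable (fun x => le_max_right _ _)
    (thompsonDist_nonneg hO hP e) (h₂.lintegral_lt_top hO hP hp e))

/-- Uniform integrability of the `p`-th power of the Thompson distance over an order interval. -/
theorem exists_forall_lintegral_excess_le (hO : IsOpen (C : Set E))
    (hP : closure (C : Set E) ∩ -closure (C : Set E) = {0}) {p : ℝ} (hp : 0 ≤ p)
    (h₁ : HasFiniteMoment C p ν₁) (h₂ : HasFiniteMoment C p ν₂) (e : Points C) {ε : ℝ≥0∞}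
    (hε : 0 < ε) :
    ∃ n : ℕ, ∀ μ ∈ stochInterval C ν₁ ν₂,
      ∫⁻ x, ENNReal.ofReal (excess p n (thompsonDist C e x)) ∂(μ : Measure (Points C)) ≤ ε := by
  obtain ⟨n, hn⟩ := ((tendsto_lintegral_excess_logRatio hO hP hp h₁ h₂ e).eventually
    (eventually_le_nhds hε)).exists
  exact ⟨n, fun μ hμ => (lintegral_excess_thompsonDist_le hO hP hp hμ e).trans hn⟩

theorem hasFiniteMoment_of_mem_stochInterval (hO : IsOpen (C : Set E))
    (hP : closure (C : Set E) ∩ -closure (C : Set E) = {0}) {p : ℝ} (hp : 0 ≤ p)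
    (h₁ : HasFiniteMoment C p ν₁) (h₂ : HasFiniteMoment C p ν₂)
    (hμ : μ ∈ stochInterval C ν₁ ν₂) : HasFiniteMoment C p μ := by
  obtain ⟨e, -⟩ := id h₁
  obtain ⟨n, hn⟩ := exists_forall_lintegral_excess_le hO hP hp h₁ h₂ e one_pos
  refine ⟨e, (lintegral_rpow_le_of_le hO hP n.cast_nonneg e le_rfl).trans_lt ?_⟩
  refine ENNReal.add_lt_top.2 ⟨?_, (hn μ hμ).trans_lt ENNReal.one_lt_top⟩
  exact ENNReal.mul_lt_top ENNReal.ofReal_lt_top (measure_lt_top _ _)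

end Integrals

/-! ### Couplings of weakly close measures -/

section Coupling

open Filter Topology BoundedContinuousFunction
open scoped NNReal

/-- A partial coupling of two probability measures extends to a coupling, by the normalized
product of the two remainders. -/
theorem exists_coupling_of_partial {X : Type*} [MeasurableSpace X] (μ ν : Measure X)
    [IsProbabilityMeasure μ] [IsProbabilityMeasure ν] (π : Measure (X × X))
    (h1 : π.map Prod.fst ≤ μ) (h2 : π.map Prod.snd ≤ ν) :
    ∃ ρ : Measure (X × X), (π + ρ).map Prod.fst = μ ∧ (π + ρ).map Prod.snd = ν := by
  have e1 : (π.map Prod.fst) univ = π univ := by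
    rw [Measure.map_apply measurable_fst .univ, preimage_univ]
  have e2 : (π.map Prod.snd) univ = π univ := by
    rw [Measure.map_apply measurable_snd .univ, preimage_univ]
  have f1 : IsFiniteMeasure (π.map Prod.fst) := isFiniteMeasure_of_le μ h1
  have f2 : IsFiniteMeasure (π.map Prod.snd) := isFiniteMeasure_of_le ν h2
  set a : Measure X := μ - π.map Prod.fst with ha
  set b : Measure X := ν - π.map Prod.snd with hb
  have hab : a univ = b univ := by
    rw [ha, hb, Measure.sub_apply .univ h1, Measure.sub_apply .univ h2, e1, e2,
      measure_univ (μ := μ), measure_univ (μ := ν)]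
  have : IsFiniteMeasure a := isFiniteMeasure_of_le μ Measure.sub_le
  have : IsFiniteMeasure b := isFiniteMeasure_of_le ν Measure.sub_le
  refine ⟨(a univ)⁻¹ • a.prod b, ?_, ?_⟩
  · rw [Measure.map_add _ _ measurable_fst, Measure.map_smul, Measure.map_fst_prod, smul_smul,
      ← hab]
    -- if `a` and `b` vanish, the factor `(a univ)⁻¹ = ∞` is harmless
    rcases eq_or_ne (a univ) 0 with h | h
    · have h0 : a = 0 := Measure.measure_univ_eq_zero.1 h
      rw [h0, smul_zero, ← h0, add_comm]
      exact Measure.sub_add_cancel_of_le h1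
    · rw [ENNReal.inv_mul_cancel h (measure_ne_top _ _), one_smul, add_comm]
      exact Measure.sub_add_cancel_of_le h1
  · rw [Measure.map_add _ _ measurable_snd, Measure.map_smul, Measure.map_snd_prod, smul_smul]
    rcases eq_or_ne (a univ) 0 with h | h
    · have h0 : b = 0 := Measure.measure_univ_eq_zero.1 (hab ▸ h)
      rw [h0, smul_zero, ← h0, add_comm]
      exact Measure.sub_add_cancel_of_le h2
    · rw [ENNReal.inv_mul_cancel h (measure_ne_top _ _), one_smul, add_comm]
      exact Measure.sub_add_cancel_of_le h2

/-- Given functions `φ i` with sum at most `1`, each supported where the cost `c` is at most `δ`,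
transporting `φ i • μ` to `φ i • ν` by (rescaled) products gives a partial coupling of mass
`∑ i, min (∫ φ i dμ) (∫ φ i dν)` and cost at most `δ`. -/
theorem exists_partial_coupling {X ι : Type*} [MeasurableSpace X] [Fintype ι]
    {c : X × X → ℝ≥0∞} (hc : Measurable c) {δ : ℝ≥0∞} (φ : ι → X → ℝ≥0∞)
    (hφ : ∀ i, Measurable (φ i)) (hsum : ∀ x, ∑ i, φ i x ≤ 1)
    (hsupp : ∀ i x y, φ i x ≠ 0 → φ i y ≠ 0 → c (x, y) ≤ δ)
    (μ ν : Measure X) [IsProbabilityMeasure μ] [IsProbabilityMeasure ν] :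
    ∃ π : Measure (X × X), π.map Prod.fst ≤ μ ∧ π.map Prod.snd ≤ ν ∧
      π univ = ∑ i, min (∫⁻ x, φ i x ∂μ) (∫⁻ x, φ i x ∂ν) ∧ ∫⁻ z, c z ∂π ≤ δ := by
  let M : ι → Measure X := fun i => μ.withDensity (φ i)
  let N : ι → Measure X := fun i => ν.withDensity (φ i)
  have hφ1 : ∀ i x, φ i x ≤ 1 := fun i x =>
    (Finset.single_le_sum (f := fun i => φ i x) (fun _ _ => zero_le) (Finset.mem_univ i)).trans
      (hsum x)
  have hle : ∀ (m : Measure X), ∑ i, m.withDensity (φ i) ≤ m := fun m => by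
    rw [Measure.le_iff]
    intro s hs
    rw [Measure.finsetSum_apply]
    simp_rw [withDensity_apply _ hs]
    rw [← lintegral_finsetSum _ fun i _ => hφ i]
    calc ∫⁻ x in s, ∑ i, φ i x ∂m ≤ ∫⁻ x in s, 1 ∂m := lintegral_mono hsum
      _ = m s := by simp
  have hMuniv : ∀ i, M i univ = ∫⁻ x, φ i x ∂μ := fun i => by
    simp [M, withDensity_apply]
  have hNuniv : ∀ i, N i univ = ∫⁻ x, φ i x ∂ν := fun i => by
    simp [N, withDensity_apply]
  have hfin : ∀ (m : Measure X) [IsProbabilityMeasure m] (i : ι), ∫⁻ x, φ i x ∂m ≠ ∞ :=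
    fun m _ i => ne_top_of_le_ne_top ENNReal.one_ne_top
      ((lintegral_mono (hφ1 i)).trans (by simp))
  have hMf : ∀ i, IsFiniteMeasure (M i) := fun i => ⟨by rw [hMuniv]; exact (hfin μ i).lt_top⟩
  have hNf : ∀ i, IsFiniteMeasure (N i) := fun i => ⟨by rw [hNuniv]; exact (hfin ν i).lt_top⟩
  let w : ι → ℝ≥0∞ := fun i => (max (M i univ) (N i univ))⁻¹
  have hw1 : ∀ i, w i * N i univ ≤ 1 := fun i =>
    (mul_le_mul_right (le_max_right (M i univ) (N i univ)) _).trans (ENNReal.inv_mul_le_one _)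
  have hw2 : ∀ i, w i * M i univ ≤ 1 := fun i =>
    (mul_le_mul_right (le_max_left (M i univ) (N i univ)) _).trans (ENNReal.inv_mul_le_one _)
  have hsmul : ∀ (t : ℝ≥0∞) (m : Measure X), t ≤ 1 → t • m ≤ m := fun t m ht => by
    rw [Measure.le_iff]
    intro s _
    rw [Measure.smul_apply, smul_eq_mul]
    exact mul_le_of_le_one_left zero_le ht
  let π : Measure (X × X) := ∑ i, w i • (M i).prod (N i)
  have hfst : π.map Prod.fst ≤ μ := by
    refine le_trans ?_ (hle μ)
    rw [Measure.map_finset_sum measurable_fst.aemeasurable]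
    refine Finset.sum_le_sum fun i _ => ?_
    rw [Measure.map_smul, Measure.map_fst_prod, smul_smul]
    exact hsmul _ _ (hw1 i)
  have hsnd : π.map Prod.snd ≤ ν := by
    refine le_trans ?_ (hle ν)
    rw [Measure.map_finset_sum measurable_snd.aemeasurable]
    refine Finset.sum_le_sum fun i _ => ?_
    rw [Measure.map_smul, Measure.map_snd_prod, smul_smul]
    exact hsmul _ _ (hw2 i)
  refine ⟨π, hfst, hsnd, ?_, ?_⟩
  · rw [Measure.finsetSum_apply]
    refine Finset.sum_congr rfl fun i _ => ?_
    rw [Measure.smul_apply, smul_eq_mul, ← univ_prod_univ, Measure.prod_prod, ← hMuniv, ← hNuniv,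
      ← max_mul_min (M i univ) (N i univ), ← mul_assoc]
    -- if the maximum is `0`, the weight `w i` is `∞`, but the product measure vanishes
    rcases eq_or_ne (max (M i univ) (N i univ)) 0 with h | h
    · have h' : min (M i univ) (N i univ) = 0 :=
        le_antisymm ((min_le_left _ _).trans ((le_max_left _ _).trans h.le)) zero_le
      rw [h', mul_zero]
    · rw [ENNReal.inv_mul_cancel h (max_lt (measure_lt_top _ _) (measure_lt_top _ _)).ne, one_mul]
  · have hmass : π univ ≤ 1 := by
      have := hfst univ
      rwa [Measure.map_apply measurable_fst .univ, preimage_univ, measure_univ (μ := μ)] at this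
    calc ∫⁻ z, c z ∂π = ∑ i, w i * ∫⁻ z, c z ∂(M i).prod (N i) := by
          rw [lintegral_finsetSum_measure]
          simp_rw [lintegral_smul_measure, smul_eq_mul]
      _ ≤ ∑ i, w i * (δ * (M i).prod (N i) univ) := by
          gcongr with i
          have hden : Measurable fun z : X × X => φ i z.1 * φ i z.2 :=
            ((hφ i).comp measurable_fst).mul ((hφ i).comp measurable_snd)
          have hsf : SFinite (ν.withDensity (φ i)) := inferInstanceAs (SFinite (N i))
          rw [show (M i).prod (N i) = (μ.prod ν).withDensity fun z => φ i z.1 * φ i z.2 from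
            prod_withDensity (hφ i) (hφ i), lintegral_withDensity_eq_lintegral_mul _ hden hc,
            withDensity_apply _ .univ, Measure.restrict_univ, ← lintegral_const_mul _ hden]
          refine lintegral_mono fun z => ?_
          rw [Pi.mul_apply, mul_comm δ]
          rcases eq_or_ne (φ i z.1) 0 with h | h
          · simp [h]
          rcases eq_or_ne (φ i z.2) 0 with h' | h'
          · simp [h']
          exact mul_le_mul_right (hsupp i z.1 z.2 h h') _
      _ = δ * π univ := by
          rw [Measure.finsetSum_apply, Finset.mul_sum]
          refine Finset.sum_congr rfl fun i _ => ?_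
          rw [Measure.smul_apply, smul_eq_mul]
          ring
      _ ≤ δ := mul_le_of_le_one_right zero_le hmass

/-- A probability measure weakly close to `μ` admits a partial coupling with `μ` of mass close
to `1` and small cost. The partial coupling uses a finite continuous partition of unity on a
compact set carrying most of the mass of `μ`; its mass depends continuously on `ν`. -/
theorem eventually_exists_partial_coupling {X : Type*} [MetricSpace X] [MeasurableSpace X]
    [BorelSpace X] {c : X × X → ℝ≥0∞} (hc : Measurable c) {δ : ℝ≥0∞}
    (hcδ : ∀ x, ∃ U ∈ 𝓝 x, ∀ y ∈ U, ∀ z ∈ U, c (y, z) ≤ δ)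
    (μ : ProbabilityMeasure X) (hμ : IsTightMeasureSet {(μ : Measure X)}) {η : ℝ≥0∞}
    (hη : 0 < η) :
    ∀ᶠ ν : ProbabilityMeasure X in 𝓝 μ, ∃ π : Measure (X × X), π.map Prod.fst ≤ μ ∧
      π.map Prod.snd ≤ ν ∧ 1 ≤ π univ + η ∧ ∫⁻ z, c z ∂π ≤ δ := by
  obtain ⟨η', hη'0, hη'⟩ := exists_between hη
  obtain ⟨K, hK, hKμ⟩ := isTightMeasureSet_iff_exists_isCompact_measure_compl_le.1 hμ η' hη'0
  have hKμ' : (μ : Measure X) Kᶜ ≤ η' := hKμ _ rfl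
  choose U hU hUc using hcδ
  obtain ⟨t, -, ht⟩ := hK.elim_nhds_subcover (fun x => interior (U x))
    fun x _ => interior_mem_nhds.2 (hU x)
  have hcover : K ⊆ ⋃ i : t, interior (U i) := by
    rwa [iUnion_subtype]
  obtain ⟨f, hf⟩ := PartitionOfUnity.exists_isSubordinate_of_locallyFinite hK.isClosed
    (fun i : t => interior (U i)) (fun i => isOpen_interior) (locallyFinite_of_finite _) hcover
  let ψ : t → X →ᵇ ℝ≥0 := fun i => BoundedContinuousFunction.mkOfBound
    ⟨fun x => (f i x).toNNReal, by fun_prop⟩ 1 fun x y => by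
      have h := NNReal.dist_eq (f i x).toNNReal (f i y).toNNReal
      simp only [ContinuousMap.coe_mk]
      rw [h, Real.coe_toNNReal _ (f.nonneg i x), Real.coe_toNNReal _ (f.nonneg i y), abs_le]
      constructor <;> linarith [f.nonneg i x, f.nonneg i y, f.le_one i x, f.le_one i y]
  have hψ : ∀ i x, (ψ i x : ℝ≥0∞) = ENNReal.ofReal (f i x) := fun i x => rfl
  have hψsum : ∀ x, ∑ i, (ψ i x : ℝ≥0∞) = ENNReal.ofReal (∑ᶠ i, f i x) := fun x => by
    rw [finsum_eq_sum_of_fintype, ENNReal.ofReal_sum_of_nonneg fun i _ => f.nonneg i x]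
    rfl
  have hψm : ∀ i, Measurable fun x => (ψ i x : ℝ≥0∞) := fun i =>
    (ψ i).continuous.measurable.coe_nnreal_ennreal
  have hmass : 1 < ∑ i, min (∫⁻ x, ψ i x ∂(μ : Measure X)) (∫⁻ x, ψ i x ∂(μ : Measure X)) + η := by
    simp_rw [min_self]
    rw [← lintegral_finsetSum _ fun i _ => hψm i]
    calc (1 : ℝ≥0∞) = (μ : Measure X) K + (μ : Measure X) Kᶜ := by
          rw [measure_add_measure_compl hK.measurableSet, measure_univ]
      _ ≤ (μ : Measure X) K + η' := by gcongr
      _ < (μ : Measure X) K + η := by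
          exact ENNReal.add_lt_add_left (measure_ne_top _ _) hη'
      _ ≤ _ := by
          gcongr
          rw [← lintegral_indicator_one hK.measurableSet]
          refine lintegral_mono fun x => ?_
          by_cases hx : x ∈ K
          · rw [hψsum, f.sum_eq_one hx]
            simp [hx]
          · simp [hx]
  have hcont : Continuous fun ν : ProbabilityMeasure X =>
      ∑ i, min (∫⁻ x, ψ i x ∂(μ : Measure X)) (∫⁻ x, ψ i x ∂(ν : Measure X)) + η :=
    (continuous_finsetSum _ fun i _ => continuous_const.min
      (ProbabilityMeasure.continuous_lintegral_boundedContinuousFunction (ψ i))).add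
      continuous_const
  filter_upwards [hcont.continuousAt.eventually (lt_mem_nhds hmass)] with ν hν
  obtain ⟨π, h1, h2, h3, h4⟩ := exists_partial_coupling hc (fun i x => (ψ i x : ℝ≥0∞)) hψm
    (fun x => by
      rw [hψsum]
      exact ENNReal.ofReal_le_one.2 (f.sum_le_one x))
    (fun i x y hx hy => by
      have hmem : ∀ z, (ψ i z : ℝ≥0∞) ≠ 0 → z ∈ U i := fun z hz => by
        refine interior_subset (hf i (subset_tsupport _ fun h => hz ?_))
        rw [hψ, h, ENNReal.ofReal_zero]
      exact hUc i x (hmem x hx) y (hmem y hy)) (μ : Measure X) (ν : Measure X)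
  exact ⟨π, h1, h2, h3 ▸ hν.le, h4⟩

end Coupling

/-! ### Wasserstein compactness -/

section Wasserstein

open Filter Topology

variable {E : Type*} [NormedAddCommGroup E] [NormedSpace ℝ E]
  [MeasurableSpace E] [BorelSpace E] {C : ConvexCone ℝ E}

/-- A part `ρ` of small mass of a coupling of `m` and `n` costs little, uniformly over measures
`m`, `n` with small excess: its cost is bounded by the `p`-th moments of its marginals. -/
theorem lintegral_cost_le (hO : IsOpen (C : Set E))
    (hP : closure (C : Set E) ∩ -closure (C : Set E) = {0}) {p R : ℝ} (hp : 0 ≤ p) (hR : 0 ≤ R)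
    (e : Points C) {ρ : Measure (Points C × Points C)} {m n : Measure (Points C)}
    (h1 : ρ.map Prod.fst ≤ m) (h2 : ρ.map Prod.snd ≤ n) {η ε : ℝ≥0∞} (hη : ρ univ ≤ η)
    (hm : ∫⁻ x, ENNReal.ofReal (excess p R (thompsonDist C e x)) ∂m ≤ ε)
    (hn : ∫⁻ x, ENNReal.ofReal (excess p R (thompsonDist C e x)) ∂n ≤ ε) :
    ∫⁻ z, ENNReal.ofReal (thompsonDist C z.1 z.2 ^ p) ∂ρ ≤
      ENNReal.ofReal (2 ^ p) * (2 * (ENNReal.ofReal R * η + ε)) := by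
  have hmeas : Measurable fun x : Points C => ENNReal.ofReal (thompsonDist C e x ^ p) :=
    ((continuous_thompsonDist_right hO hP e).measurable.pow_const p).ennreal_ofReal
  have u1 : (ρ.map Prod.fst) univ ≤ η := by
    rwa [Measure.map_apply measurable_fst .univ, preimage_univ]
  have u2 : (ρ.map Prod.snd) univ ≤ η := by
    rwa [Measure.map_apply measurable_snd .univ, preimage_univ]
  calc ∫⁻ z, ENNReal.ofReal (thompsonDist C z.1 z.2 ^ p) ∂ρ
      ≤ ∫⁻ z, ENNReal.ofReal (2 ^ p) * (ENNReal.ofReal (thompsonDist C e z.1 ^ p) +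
          ENNReal.ofReal (thompsonDist C e z.2 ^ p)) ∂ρ := by
        refine lintegral_mono fun z => le_trans (ENNReal.ofReal_le_ofReal ?_)
          (ofReal_add_rpow_le (thompsonDist_nonneg hO hP e z.1) (thompsonDist_nonneg hO hP e z.2)
            hp)
        refine Real.rpow_le_rpow (thompsonDist_nonneg hO hP _ _) ?_ hp
        rw [thompsonDist_comm e z.1]
        exact thompsonDist_triangle hO hP z.1 e z.2
    _ = ENNReal.ofReal (2 ^ p) *
        (∫⁻ x, ENNReal.ofReal (thompsonDist C e x ^ p) ∂(ρ.map Prod.fst) +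
          ∫⁻ x, ENNReal.ofReal (thompsonDist C e x ^ p) ∂(ρ.map Prod.snd)) := by
        rw [lintegral_map hmeas measurable_fst, lintegral_map hmeas measurable_snd,
          lintegral_const_mul' _ _ ENNReal.ofReal_ne_top]
        congr 1
        exact lintegral_add_left (hmeas.comp measurable_fst) _
    _ ≤ ENNReal.ofReal (2 ^ p) * (2 * (ENNReal.ofReal R * η + ε)) := by
        rw [two_mul]
        gcongr
        · exact (lintegral_rpow_le_of_le hO hP hR e h1).trans (by gcongr)
        · exact (lintegral_rpow_le_of_le hO hP hR e h2).trans (by gcongr)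

variable [FiniteDimensional ℝ E] {μ ν₁ ν₂ : ProbabilityMeasure (Points C)}

/-- On an order interval with ends of finite `p`-th moment, weak neighbourhoods are contained in
Wasserstein balls. -/
theorem eventually_wassersteinDist_lt (hO : IsOpen (C : Set E))
    (hP : closure (C : Set E) ∩ -closure (C : Set E) = {0}) {p : ℝ} (hp : 0 < p)
    (h₁ : HasFiniteMoment C p ν₁) (h₂ : HasFiniteMoment C p ν₂)
    (hμ : μ ∈ stochInterval C ν₁ ν₂) {ε : ℝ} (hε : 0 < ε) :
    ∀ᶠ ν in 𝓝 μ, ν ∈ stochInterval C ν₁ ν₂ → wassersteinDist C p μ ν < ε := by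
  obtain ⟨e, -⟩ := id h₁
  -- the cost budget `κ` is split into `κ / 4` for short transports and, after the loss of the
  -- factor `k` from the triangle inequality, `κ / 4` each for the bounded and the excess part
  -- of the remaining transports
  set κ : ℝ := ε ^ p with hκ
  have hκ0 : 0 < κ := Real.rpow_pos_of_pos hε p
  set k : ℝ := 2 ^ p * 2 with hk
  have hk0 : 0 < k := by positivity
  obtain ⟨n, hn⟩ := exists_forall_lintegral_excess_le hO hP hp.le h₁ h₂ e
    (ε := ENNReal.ofReal (κ / (4 * k))) (ENNReal.ofReal_pos.2 (by positivity))
  set η : ℝ := κ / (4 * k * (n + 1)) with hη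
  have hη0 : 0 < η := by positivity
  have hloc := fun x : Points C => exists_mem_nhds_cost_le hO hP hp x
    (show 0 < κ / 4 by positivity)
  have hc := (continuous_cost hO hP hp.le).measurable.ennreal_ofReal
  have htight : IsTightMeasureSet {(μ : Measure (Points C))} :=
    (isTightMeasureSet_stochInterval hO hP ν₁ ν₂).subset
      (singleton_subset_iff.2 ⟨μ, hμ, rfl⟩)
  filter_upwards [eventually_exists_partial_coupling hc hloc μ htight
    (ENNReal.ofReal_pos.2 hη0)] with ν ⟨π, hπ1, hπ2, hπη, hπδ⟩ hν
  obtain ⟨ρ, hρ1, hρ2⟩ := exists_coupling_of_partial (μ : Measure (Points C))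
    (ν : Measure (Points C)) π hπ1 hπ2
  have huniv : (π + ρ) univ = 1 := by
    rw [← preimage_univ (f := Prod.fst), ← Measure.map_apply measurable_fst .univ, hρ1,
      measure_univ]
  have hprob : IsProbabilityMeasure (π + ρ) := ⟨huniv⟩
  have hρη : ρ univ ≤ ENNReal.ofReal η := by
    rw [Measure.add_apply] at huniv
    rw [← huniv] at hπη
    refine (ENNReal.add_le_add_iff_left (ne_top_of_le_ne_top ENNReal.one_ne_top ?_)).1 hπη
    exact huniv ▸ le_self_add
  have hm1 : ρ.map Prod.fst ≤ μ := by
    rw [← hρ1, Measure.map_add _ _ measurable_fst]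
    exact Measure.le_add_left le_rfl
  have hm2 : ρ.map Prod.snd ≤ ν := by
    rw [← hρ2, Measure.map_add _ _ measurable_snd]
    exact Measure.le_add_left le_rfl
  have hcost := lintegral_cost_le hO hP hp.le n.cast_nonneg e hm1 hm2 hρη (hn μ hμ) (hn ν hν)
  have hlt : (⨅ π ∈ couplings C μ ν, ∫⁻ z, ENNReal.ofReal (thompsonDist C z.1 z.2 ^ p)
      ∂(π : Measure (Points C × Points C))) < ENNReal.ofReal κ := by
    refine lt_of_le_of_lt (iInf₂_le (⟨π + ρ, hprob⟩ : ProbabilityMeasure _) ⟨hρ1, hρ2⟩) ?_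
    rw [ProbabilityMeasure.coe_mk, lintegral_add_measure]
    refine lt_of_le_of_lt (add_le_add hπδ hcost) ?_
    have h2 : (2 : ℝ≥0∞) = ENNReal.ofReal 2 := by simp
    rw [h2, ← ENNReal.ofReal_mul n.cast_nonneg, ← ENNReal.ofReal_add (by positivity)
      (by positivity), ← ENNReal.ofReal_mul zero_le_two, ← ENNReal.ofReal_mul (by positivity),
      ← ENNReal.ofReal_add (by positivity) (by positivity)]
    refine (ENNReal.ofReal_lt_ofReal_iff hκ0).2 ?_
    have e1 : (n : ℝ) * η ≤ κ / (4 * k) := by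
      rw [hη, ← mul_div_assoc, div_le_div_iff₀ (by positivity) (by positivity)]
      have : 0 ≤ κ * (4 * k) := by positivity
      nlinarith
    have e2 : k * (κ / (4 * k)) = κ / 4 := by
      field_simp
    have e3 : (2 : ℝ) ^ p * (2 * (n * η + κ / (4 * k))) = k * (n * η) + κ / 4 := by
      rw [← e2, hk]
      ring
    have e4 : k * (n * η) ≤ κ / 4 := e2 ▸ mul_le_mul_of_nonneg_left e1 hk0.le
    rw [e3]
    linarith
  rw [wassersteinDist]
  calc _ < κ ^ (1 / p) := by
        refine Real.rpow_lt_rpow ENNReal.toReal_nonneg ?_ (by positivity)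
        exact (ENNReal.lt_ofReal_iff_toReal_lt (ne_top_of_lt hlt)).1 hlt
    _ = ε := by
        rw [hκ, one_div, Real.rpow_rpow_inv hε.le hp.ne']

/-- The order interval is the image of its weakly compact copy under a continuous map into the
Wasserstein space. -/
theorem isCompact_setOf_toProb_mem_stochInterval (hO : IsOpen (C : Set E))
    (hP : closure (C : Set E) ∩ -closure (C : Set E) = {0}) {p : ℝ} (hp : 0 < p)
    (h₁ : HasFiniteMoment C p ν₁) (h₂ : HasFiniteMoment C p ν₂) :
    IsCompact {μ : WassersteinSpace C p | μ.toProb ∈ stochInterval C ν₁ ν₂} := by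
  have hcomp : CompactSpace (stochInterval C ν₁ ν₂) :=
    isCompact_iff_compactSpace.1 (isCompact_stochInterval hO hP ν₁ ν₂)
  let F : stochInterval C ν₁ ν₂ → WassersteinSpace C p := fun μ =>
    ⟨μ, hasFiniteMoment_of_mem_stochInterval hO hP hp.le h₁ h₂ μ.2⟩
  have hF : Continuous F := by
    refine continuous_def.2 fun U hU => isOpen_iff_mem_nhds.2 fun μ hμ => ?_
    obtain ⟨ε, hε, hball⟩ := hU (F μ) hμ
    rw [nhds_subtype]
    filter_upwards [preimage_mem_comap
      (eventually_wassersteinDist_lt hO hP hp h₁ h₂ μ.2 hε)] with ν hν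
    exact hball (F ν) (hν ν.2)
  convert isCompact_range hF using 1
  ext μ
  exact ⟨fun hμ => ⟨⟨μ.toProb, hμ⟩, rfl⟩, by
    rintro ⟨ν, rfl⟩
    exact ν.2⟩

end Wasserstein
end OpenCone

theorem proposition6p2 {E : Type*} [NormedAddCommGroup E] [NormedSpace ℝ E]
    [FiniteDimensional ℝ E] [MeasurableSpace E] [BorelSpace E]
    (C : ConvexCone ℝ E) (hC_open : IsOpen (C : Set E))
    (hC_proper : closure (C : Set E) ∩ -closure (C : Set E) = {0})
    (ν₁ ν₂ : ProbabilityMeasure (OpenCone.Points C)) (hν : OpenCone.StochLE C ν₁ ν₂) :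
    IsCompact (OpenCone.stochInterval C ν₁ ν₂) ∧
    ∀ p : ℝ, 1 ≤ p → OpenCone.HasFiniteMoment C p ν₁ → OpenCone.HasFiniteMoment C p ν₂ →
      (∀ μ ∈ OpenCone.stochInterval C ν₁ ν₂, OpenCone.HasFiniteMoment C p μ) ∧
      IsCompact {μ : OpenCone.WassersteinSpace C p |
        μ.toProb ∈ OpenCone.stochInterval C ν₁ ν₂} := by
  refine ⟨OpenCone.isCompact_stochInterval hC_open hC_proper ν₁ ν₂, fun p hp h₁ h₂ => ?_⟩
  have hp0 : 0 < p := zero_lt_one.trans_le hp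
  exact ⟨fun μ hμ => OpenCone.hasFiniteMoment_of_mem_stochInterval hC_open hC_proper hp0.le h₁ h₂ hμ,
    OpenCone.isCompact_setOf_toProb_mem_stochInterval hC_open hC_proper hp0 h₁ h₂⟩
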